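/- Let $d,e\in\mathbb N$, $T>0$, $\alpha,\beta\in(0,1]$ with $\alpha+\beta>1$. Identify the space $\mathcal M_{e,d}$ of real $e\times d$ matrices with $\mathbb R^{ed}$, with its Euclidean norm. Let $F$ be a map from $[0,T]$ to the nonempty compact convex subsets of $\mathcal M_{e,d}$ that is $\alpha$-Hölder continuous for the Hausdorff distance $d_H$, let $w:[0,T]\to\mathbb R^d$ be $\beta$-Hölder continuous, and let $r\ge 0$. For a convex-compact-valued multifunction $G$ on $[0,T]$ let $\mathcal S_{\alpha,r}(G)$ be the set of measurable selections $f$ of $G$ (that is, $f(t)\in G(t)$ for all $t\in[0,T]$) whose Hölder seminorm $\|f\|_{\alpha,T}=\sup_{0\le s<t\le T}\|f(t)-f(s)\|/|t-s|^\alpha$ is at most $r$, and let $$J_{T,\alpha,r}(G,w)=\Big\{\int_0^T f(s)\,dw(s)\ :\ f\in\mathcal S_{\alpha,r}(G)\Big\}\subset\mathbb R^e,$$ where $\int_0^T f\,dw$ is the Young integral, i.e. the common limit of the left-point Riemann sums $\sum_i f(t_i)(w(t_{i+1})-w(t_i))$ along all sequences of dissections of $[0,T]$ whose mesh tends to $0$.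 Let $D_n=(t^n_0,\dots,t^n_{m_n})$, $0=t^n_0<\dots<t^n_{m_n}=T$, be a sequence of dissections of $[0,T]$ whose mesh $|D_n|=\max_{0\le i\le m_n-1}(t^n_{i+1}-t^n_i)$ tends to $0$, and let $F_n$ be the piecewise linear interpolation of $F$ along $D_n$: for $0\le i\le m_n-1$ and $t\in[t^n_i,t^n_{i+1}]$, $$F_n(t)=\frac{t^n_{i+1}-t}{t^n_{i+1}-t^n_i}\,F(t^n_i)+\frac{t-t^n_i}{t^n_{i+1}-t^n_i}\,F(t^n_{i+1})$$ (Minkowski sum). Then $$\lim_{n\to\infty} d_H\big(J_{T,\alpha,r}(F_n,w),\,J_{T,\alpha,r}(F,w)\big)=0 .$$ Here $d_H$ takes values in $[0,\infty]$, with $d_H(\emptyset,\emptyset)=0$ and $d_H(A,\emptyset)=d_H(\emptyset,A)=\infty$ for $A\ne\emptyset$. -/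

import Mathlib

open Set Filter Topology
open scoped NNReal ENNReal Pointwise

namespace AumannYoung

/-- The space of real `e × d` matrices, i.e. of linear maps from `ℝᵈ` to `ℝᵉ`, identified with
`ℝ^(e d)` and equipped with the Euclidean (Frobenius) norm. -/
abbrev Mat (e d : ℕ) : Type := EuclideanSpace ℝ (Fin e × Fin d)

/-- The matrix-vector product `A v`. -/
noncomputable def Mat.apply {e d : ℕ} (A : Mat e d) (v : EuclideanSpace ℝ (Fin d)) :
    EuclideanSpace ℝ (Fin e) :=
  WithLp.toLp 2 fun i => ∑ j, A (i, j) * v j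

/-- A dissection `0 = t₀ < t₁ < ⋯ < t_m = T` of the interval `[0, T]`. -/
structure Dissection (T : ℝ) where
  /-- the number of subintervals -/
  m : ℕ
  /-- the nodes -/
  t : Fin (m + 1) → ℝ
  strictMono : StrictMono t
  first : t 0 = 0
  last : t (Fin.last m) = T

namespace Dissection

variable {T : ℝ}

/-- The mesh `max_i (t_{i+1} - t_i)` of a dissection. -/
noncomputable def mesh (D : Dissection T) : ℝ :=
  ⨆ i : Fin D.m, (D.t i.succ - D.t i.castSucc)

/-- The convex combination `(t_{i+1} - x)/(t_{i+1} - t_i) F(t_i) + (x - t_i)/(t_{i+1} - t_i) F(t_{i+1})`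
in the sense of Minkowski. -/
noncomputable def piece {V : Type*} [NormedAddCommGroup V] [NormedSpace ℝ V]
    (D : Dissection T) (F : ℝ → ConvexBody V) (i : Fin D.m) (x : ℝ) : ConvexBody V :=
  ((D.t i.succ - x) / (D.t i.succ - D.t i.castSucc)) • F (D.t i.castSucc) +
    ((x - D.t i.castSucc) / (D.t i.succ - D.t i.castSucc)) • F (D.t i.succ)

open Classical in
/-- The piecewise linear interpolation of a multifunction `F` along the dissection `D`. It is given
by `piece D F i` on the interval `[t_i, t_{i+1}]`, see `interpolate_eq`. Values outside of `[0, T]`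
are irrelevant. -/
noncomputable def interpolate {V : Type*} [NormedAddCommGroup V] [NormedSpace ℝ V]
    (D : Dissection T) (F : ℝ → ConvexBody V) (x : ℝ) : ConvexBody V :=
  if h : ∃ i : Fin D.m, x ∈ Icc (D.t i.castSucc) (D.t i.succ) then D.piece F h.choose x else F x

section lemmas

variable {V : Type*} [NormedAddCommGroup V] [NormedSpace ℝ V] (D : Dissection T)
  (F : ℝ → ConvexBody V)

lemma pos (i : Fin D.m) : 0 < D.t i.succ - D.t i.castSucc :=
  sub_pos.2 (D.strictMono i.castSucc_lt_succ)

lemma zero_smul_add (K L : ConvexBody V) : (0 : ℝ) • K + (1 : ℝ) • L = L := by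
  apply ConvexBody.ext
  rw [ConvexBody.coe_add, ConvexBody.coe_smul, ConvexBody.coe_smul, zero_smul_set K.nonempty,
    one_smul, zero_add]

lemma piece_left (i : Fin D.m) : D.piece F i (D.t i.castSucc) = F (D.t i.castSucc) := by
  unfold piece
  rw [sub_self, zero_div, div_self (D.pos i).ne', add_comm, zero_smul_add]

lemma piece_right (i : Fin D.m) : D.piece F i (D.t i.succ) = F (D.t i.succ) := by
  unfold piece
  rw [sub_self, zero_div, div_self (D.pos i).ne', zero_smul_add]

lemma piece_congr_of_lt {i j : Fin D.m} (hij : i < j) {x : ℝ}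
    (hi : x ∈ Icc (D.t i.castSucc) (D.t i.succ)) (hj : x ∈ Icc (D.t j.castSucc) (D.t j.succ)) :
    D.piece F i x = D.piece F j x := by
  have h1 : D.t i.succ ≤ D.t j.castSucc :=
    D.strictMono.monotone (Fin.succ_le_castSucc_iff.2 hij)
  have h2 : x = D.t i.succ := le_antisymm hi.2 (h1.trans hj.1)
  have h3 : x = D.t j.castSucc := le_antisymm (hi.2.trans h1) hj.1
  calc D.piece F i x = F x := by rw [h2, piece_right]
    _ = D.piece F j x := by rw [h3, piece_left]

/-- The interpolation is given by the expected formula on every interval of the dissection. -/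
theorem interpolate_eq (i : Fin D.m) {x : ℝ} (hx : x ∈ Icc (D.t i.castSucc) (D.t i.succ)) :
    D.interpolate F x =
      ((D.t i.succ - x) / (D.t i.succ - D.t i.castSucc)) • F (D.t i.castSucc) +
      ((x - D.t i.castSucc) / (D.t i.succ - D.t i.castSucc)) • F (D.t i.succ) := by
  have h : ∃ i : Fin D.m, x ∈ Icc (D.t i.castSucc) (D.t i.succ) := ⟨i, hx⟩
  change _ = D.piece F i x
  rw [interpolate, dif_pos h]
  rcases lt_trichotomy h.choose i with hlt | heq | hgt
  · exact D.piece_congr_of_lt F hlt h.choose_spec hx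
  · rw [heq]
  · exact (D.piece_congr_of_lt F hgt hx h.choose_spec).symm

end lemmas

/-- The left-point Riemann sum `∑ f(t_i) (w(t_{i+1}) - w(t_i))`. -/
noncomputable def riemannSum {d e : ℕ} (D : Dissection T)
    (f : ℝ → Mat e d) (w : ℝ → EuclideanSpace ℝ (Fin d)) :
    EuclideanSpace ℝ (Fin e) :=
  ∑ i : Fin D.m, (f (D.t i.castSucc)).apply (w (D.t i.succ) - w (D.t i.castSucc))

end Dissection

/-- `I` is the Young integral `∫₀ᵀ f dw`: for every sequence of dissections of `[0, T]` whose mesh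
tends to `0`, the left-point Riemann sums converge to `I`. -/
def IsYoungIntegral {d e : ℕ} (T : ℝ) (f : ℝ → Mat e d)
    (w : ℝ → EuclideanSpace ℝ (Fin d)) (I : EuclideanSpace ℝ (Fin e)) : Prop :=
  ∀ D : ℕ → Dissection T, Tendsto (fun n => (D n).mesh) atTop (𝓝 0) →
    Tendsto (fun n => (D n).riemannSum f w) atTop (𝓝 I)

/-- The set `S⁰(F)` of measurable selections of `F` on `[0, T]`. -/
def measurableSelections {d e : ℕ} (T : ℝ) (F : ℝ → ConvexBody (Mat e d)) :
    Set (ℝ → Mat e d) :=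
  {f | Measurable ((Icc 0 T).domRestrict f) ∧ ∀ t ∈ Icc 0 T, f t ∈ F t}

/-- The set `S_{α,r}(F)` of measurable selections of `F` on `[0, T]` whose `α`-Hölder seminorm is
at most `r`. -/
def holderSelections {d e : ℕ} (T : ℝ) (α r : ℝ≥0)
    (F : ℝ → ConvexBody (Mat e d)) : Set (ℝ → Mat e d) :=
  {f | f ∈ measurableSelections T F ∧ HolderOnWith r α f (Icc 0 T)}

/-- The Aumann-Young integral `J_{T,α,r}(F, w)`: the set of Young integrals `∫₀ᵀ f dw` of the
selections `f` in `S_{α,r}(F)`. -/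
def integral {d e : ℕ} (T : ℝ) (α r : ℝ≥0) (F : ℝ → ConvexBody (Mat e d))
    (w : ℝ → EuclideanSpace ℝ (Fin d)) : Set (EuclideanSpace ℝ (Fin e)) :=
  {j | ∃ f ∈ holderSelections T α r F, IsYoungIntegral T f w j}

end AumannYoung

/-! ### Discrete sewing along monotone sequences -/

namespace AumannYoung

/-! Everything rests on a uniform Young estimate: the Riemann sum along `D` differs from the
integral by at most `K * D.mesh ^ (α + β - 1)`, with one `K` for all integrands of Hölder constant
`r`. It follows from discrete sewing and common refinements
(`exists_norm_riemannSum_sub_riemannSum_le`).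

From `F` to its interpolation: interpolating a selection of `F` along `D n` gives a selection of the
interpolated multifunction, by definition of the Minkowski sum. Concavity of `t ↦ t ^ α` keeps the
Hölder constant at `r`, and the Riemann sum along `D n` is unchanged, so the integrals are close by
Young's estimate.

Back to `F`: otherwise infinitely many `n` carry an integral that stays `δ` away from the set for
`F`. Along an ultrafilter of such `n` the selections converge pointwise to a Hölder selection of
`F`, by compactness of the values. A Riemann sum along one fixed fine dissection involves finitely
many points, hence converges, and two uses of Young's estimate give a contradiction. -/

/-- The discrete sewing lemma: an almost additive two-parameter function is close to its sums along
monotone sequences. -/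
theorem exists_norm_sum_Ico_sub_le {E : Type*} [NormedAddCommGroup E] {p M : ℝ} (hp : 1 < p)
    (hM : 0 ≤ M) : ∃ K, 0 ≤ K ∧ ∀ (S : Set ℝ) (A : ℝ → ℝ → E),
      (∀ a ∈ S, ∀ b ∈ S, ∀ c ∈ S, a ≤ b → b ≤ c → ‖A a b + A b c - A a c‖ ≤ M * (c - a) ^ p) →
      ∀ t : ℕ → ℝ, Monotone t → (∀ k, t k ∈ S) → ∀ i j, i ≤ j →
        ‖∑ k ∈ Finset.Ico i j, A (t k) (t (k + 1)) - A (t i) (t j)‖ ≤ K * (t j - t i) ^ p := by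
  have hp0 : p ≠ 0 := by linarith
  set q : ℝ := (1 / 2 : ℝ) ^ p with hq
  have hq1 : q < 1 / 2 := by
    have := Real.rpow_lt_rpow_of_exponent_gt (x := (1 / 2 : ℝ)) (by norm_num) (by norm_num) hp
    rwa [Real.rpow_one] at this
  have hq2 : 0 < 1 - 2 * q := by linarith
  -- The constant solves `K = 2 * (K * q) + 2 * M`: two sub-blocks of at most half the length, and
  -- two almost-additivity defects. It is finite because `p > 1` gives `2 * q < 1`.
  refine ⟨2 * M / (1 - 2 * q), by positivity, fun S A hA t ht htS i j => ?_⟩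
  set K := 2 * M / (1 - 2 * q) with hK
  have hK0 : 0 ≤ K := by positivity
  have hKq : 2 * (K * q) + 2 * M = K := by
    rw [hK]; field_simp; ring
  have half : ∀ x L : ℝ, 0 ≤ x → x ≤ L / 2 → K * x ^ p ≤ K * q * L ^ p := by
    intro x L hx hxL
    have h1 : x ^ p ≤ (1 / 2 * L) ^ p := Real.rpow_le_rpow hx (by linarith) (by linarith)
    rw [Real.mul_rpow (by norm_num) (by linarith)] at h1
    calc K * x ^ p ≤ K * ((1 / 2) ^ p * L ^ p) := by gcongr
      _ = K * q * L ^ p := by rw [hq]; ring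
  induction hn : j - i using Nat.strong_induction_on generalizing i j with
  | _ n ih =>
  intro hij
  rcases hij.eq_or_lt with rfl | hlt
  -- The sum is empty; taking the three points equal forces `A (t i) (t i) = 0`.
  · have := hA (t i) (htS i) (t i) (htS i) (t i) (htS i) le_rfl le_rfl
    simp only [sub_self, Real.zero_rpow hp0, mul_zero, add_sub_cancel_right] at this ⊢
    simpa using this
  set L := t j - t i with hL
  have hL0 : 0 ≤ L := sub_nonneg.2 (ht hij)
  -- `k + 1` is the first index after `i` at or beyond the midpoint. The step from `k` to `k + 1` is
  -- split off, so both remaining blocks have length at most `L / 2`, however uneven the nodes.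
  obtain ⟨k, hik, hkj, hk1, hk2⟩ : ∃ k, i ≤ k ∧ k < j ∧ t k - t i ≤ L / 2 ∧
      t j - t (k + 1) ≤ L / 2 := by
    classical
    have hex : ∃ l, i < l ∧ L / 2 ≤ t l - t i := ⟨j, hlt, by linarith⟩
    obtain ⟨h1, h2⟩ := Nat.find_spec hex
    have h3 := Nat.find_min' hex ⟨hlt, by linarith⟩
    obtain ⟨k, hk⟩ : ∃ k, Nat.find hex = k + 1 := ⟨Nat.find hex - 1, by omega⟩
    have h4 := Nat.find_min hex (m := k) (by omega)
    rw [hk] at h1 h2 h3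
    refine ⟨k, by omega, by omega, ?_, by linarith⟩
    rcases (Nat.lt_succ_iff.1 h1).eq_or_lt with rfl | h5
    · simp only [sub_self]; linarith
    · by_contra hcon
      exact h4 ⟨h5, by linarith⟩
  have e1 := ih (k - i) (by omega) i k rfl hik
  have e2 := ih (j - (k + 1)) (by omega) (k + 1) j rfl hkj
  have m1 := ht hik
  have m2 := ht (Nat.le_succ k)
  have m3 := ht (Nat.succ_le_of_lt hkj)
  have e3 := hA _ (htS i) _ (htS k) _ (htS (k + 1)) m1 m2
  have e4 := hA _ (htS i) _ (htS (k + 1)) _ (htS j) (m1.trans m2) m3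
  have e5 : M * (t (k + 1) - t i) ^ p ≤ M * L ^ p := by
    gcongr
    · linarith
    · linarith
  have h1 := half _ L (sub_nonneg.2 m1) hk1
  have h2 := half _ L (sub_nonneg.2 m3) hk2
  have key : ∑ k ∈ Finset.Ico i j, A (t k) (t (k + 1)) - A (t i) (t j) =
      (∑ l ∈ Finset.Ico i k, A (t l) (t (l + 1)) - A (t i) (t k)) +
      (∑ l ∈ Finset.Ico (k + 1) j, A (t l) (t (l + 1)) - A (t (k + 1)) (t j)) +
      (A (t i) (t k) + A (t k) (t (k + 1)) - A (t i) (t (k + 1))) +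
      (A (t i) (t (k + 1)) + A (t (k + 1)) (t j) - A (t i) (t j)) := by
    rw [← Finset.sum_Ico_consecutive _ hik hkj.le, Finset.sum_eq_sum_Ico_succ_bot hkj]
    abel
  rw [key]
  refine (norm_add_le _ _).trans ((add_le_add (norm_add_le _ _) le_rfl).trans ?_)
  have h3 := norm_add_le
    (∑ l ∈ Finset.Ico i k, A (t l) (t (l + 1)) - A (t i) (t k))
    (∑ l ∈ Finset.Ico (k + 1) j, A (t l) (t (l + 1)) - A (t (k + 1)) (t j))
  calc _ ≤ 2 * (K * q * L ^ p) + 2 * (M * L ^ p) := by linarith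
    _ = (2 * (K * q) + 2 * M) * L ^ p := by ring
    _ = K * L ^ p := by rw [hKq]

/-! ### Refinement of dissections -/

namespace Dissection

variable {T : ℝ} (D : Dissection T)

/-- The nodes of a dissection, as a sequence that is constant after the last one. -/
noncomputable def seq (k : ℕ) : ℝ := D.t ⟨min k D.m, by omega⟩

lemma seq_monotone : Monotone D.seq := fun i j h =>
  D.strictMono.monotone (by simp only [Fin.mk_le_mk]; omega)

lemma seq_coe (i : Fin (D.m + 1)) : D.seq i = D.t i := by
  unfold seq
  congr 1
  ext
  simp only
  omega

lemma seq_zero : D.seq 0 = 0 := by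
  exact (D.seq_coe 0).trans D.first

lemma seq_m : D.seq D.m = T := by
  exact (D.seq_coe (Fin.last D.m)).trans D.last

lemma t_mem (i : Fin (D.m + 1)) : D.t i ∈ Icc 0 T :=
  ⟨D.first.ge.trans (D.strictMono.monotone (Fin.zero_le i)),
    (D.strictMono.monotone (Fin.le_last i)).trans D.last.le⟩

lemma seq_mem (k : ℕ) : D.seq k ∈ Icc 0 T := D.t_mem _

lemma sum_eq_sum_seq {E : Type*} [AddCommMonoid E] (A : ℝ → ℝ → E) :
    ∑ i : Fin D.m, A (D.t i.castSucc) (D.t i.succ) =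
      ∑ k ∈ Finset.range D.m, A (D.seq k) (D.seq (k + 1)) := by
  rw [← Fin.sum_univ_eq_sum_range (fun k => A (D.seq k) (D.seq (k + 1)))]
  refine Finset.sum_congr rfl fun i _ => ?_
  rw [← D.seq_coe i.castSucc, ← D.seq_coe i.succ]
  rfl

lemma sub_le_mesh (i : Fin D.m) : D.t i.succ - D.t i.castSucc ≤ D.mesh :=
  le_ciSup (f := fun i : Fin D.m => D.t i.succ - D.t i.castSucc) (finite_range _).bddAbove i

lemma mesh_nonneg : 0 ≤ D.mesh := Real.iSup_nonneg fun i => (D.pos i).le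

lemma seq_sub_le_mesh (k : ℕ) : D.seq (k + 1) - D.seq k ≤ D.mesh := by
  rcases lt_or_ge k D.m with h | h
  · have := D.sub_le_mesh ⟨k, h⟩
    rw [← D.seq_coe, ← D.seq_coe] at this
    exact this
  · have : D.seq (k + 1) = D.seq k := by
      unfold seq
      congr 2
      omega
    rw [this, sub_self]
    exact D.mesh_nonneg

/-- Two dissections have a common refinement. -/
theorem exists_common_refinement (D₁ D₂ : Dissection T) :
    ∃ D : Dissection T, range D₁.t ⊆ range D.t ∧ range D₂.t ⊆ range D.t := by
  classical
  set U : Finset ℝ := Finset.univ.image D₁.t ∪ Finset.univ.image D₂.t with hU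
  have hUc : (U : Set ℝ) = range D₁.t ∪ range D₂.t := by simp [hU]
  have hUT : ∀ x ∈ U, x ∈ Icc 0 T := by
    intro x hx
    rw [← Finset.mem_coe, hUc] at hx
    rcases hx with ⟨i, rfl⟩ | ⟨i, rfl⟩
    exacts [D₁.t_mem i, D₂.t_mem i]
  have h0 : (0 : ℝ) ∈ U := by
    rw [← Finset.mem_coe, hUc]
    exact Or.inl ⟨0, D₁.first⟩
  have hT : T ∈ U := by
    rw [← Finset.mem_coe, hUc]
    exact Or.inl ⟨_, D₁.last⟩
  have hcard : U.card = (U.card - 1) + 1 := by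
    have := Finset.card_pos.2 ⟨_, h0⟩
    omega
  have hrange := Finset.range_orderEmbOfFin U hcard
  have hmem : ∀ i, U.orderEmbOfFin hcard i ∈ U := Finset.orderEmbOfFin_mem U hcard
  refine ⟨⟨U.card - 1, U.orderEmbOfFin hcard, (U.orderEmbOfFin hcard).strictMono, ?_, ?_⟩, ?_, ?_⟩
  · obtain ⟨j, hj⟩ : (0 : ℝ) ∈ range (U.orderEmbOfFin hcard) := hrange ▸ h0
    refine le_antisymm ?_ (hUT _ (hmem 0)).1
    exact ((U.orderEmbOfFin hcard).monotone (Fin.zero_le j)).trans hj.le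
  · obtain ⟨j, hj⟩ : T ∈ range (U.orderEmbOfFin hcard) := hrange ▸ hT
    refine le_antisymm (hUT _ (hmem _)).2 ?_
    exact hj.ge.trans ((U.orderEmbOfFin hcard).monotone (Fin.le_last j))
  · exact (subset_union_left.trans hUc.ge).trans hrange.ge
  · exact (subset_union_right.trans hUc.ge).trans hrange.ge

lemma sum_seq_sub : ∑ k ∈ Finset.range D.m, (D.seq (k + 1) - D.seq k) = T := by
  rw [Finset.sum_range_sub, seq_m, seq_zero, sub_zero]

/-- Each interval of `D`, of length `Δ`, costs at most `K * Δ ^ p ≤ K * D.mesh ^ (p - 1) * Δ`, and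
the lengths add up to `T`. -/
theorem norm_sum_refinement_sub_le {E : Type*} [NormedAddCommGroup E] {p K : ℝ} (hp : 1 < p)
    (hK : 0 ≤ K) (A : ℝ → ℝ → E) (D D' : Dissection T) (hDD' : range D.t ⊆ range D'.t)
    (hA : ∀ i j, i ≤ j → ‖∑ k ∈ Finset.Ico i j, A (D'.seq k) (D'.seq (k + 1)) -
      A (D'.seq i) (D'.seq j)‖ ≤ K * (D'.seq j - D'.seq i) ^ p) :
    ‖∑ i : Fin D'.m, A (D'.t i.castSucc) (D'.t i.succ) -
      ∑ i : Fin D.m, A (D.t i.castSucc) (D.t i.succ)‖ ≤ K * T * D.mesh ^ (p - 1) := by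
  choose σ hσ using fun i : Fin (D.m + 1) => hDD' (mem_range_self i)
  have hσm : Monotone σ := fun i j h => by
    rw [← D'.strictMono.le_iff_le, hσ, hσ]
    exact D.strictMono.monotone h
  set τ : ℕ → ℕ := fun k => σ ⟨min k D.m, by omega⟩ with hτ
  have hτm : Monotone τ := fun i j h => hσm (by simp only [Fin.mk_le_mk]; omega)
  have hτs : ∀ k, D'.seq (τ k) = D.seq k := fun k => by
    rw [hτ, seq_coe, hσ]
    rfl
  have hτ0 : τ 0 = 0 := by
    have : σ 0 = 0 := D'.strictMono.injective (by rw [hσ, D.first, D'.first])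
    have h2 : τ 0 = σ 0 := rfl
    rw [h2, this]
    rfl
  have hτl : τ D.m = D'.m := by
    have : σ (Fin.last _) = Fin.last _ := D'.strictMono.injective (by rw [hσ, D.last, D'.last])
    have h2 : τ D.m = σ (Fin.last _) := by
      rw [hτ]
      simp only [min_self]
      rfl
    rw [h2, this]
    rfl
  have hsum : ∀ n, ∑ i ∈ Finset.range n, ∑ k ∈ Finset.Ico (τ i) (τ (i + 1)),
      A (D'.seq k) (D'.seq (k + 1)) = ∑ k ∈ Finset.Ico 0 (τ n), A (D'.seq k) (D'.seq (k + 1)) := by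
    intro n
    induction n with
    | zero => simp [hτ0]
    | succ n ih =>
      rw [Finset.sum_range_succ, ih,
        Finset.sum_Ico_consecutive _ (Nat.zero_le _) (hτm (Nat.le_succ n))]
  have h1 := hsum D.m
  rw [hτl, ← Finset.range_eq_Ico] at h1
  rw [sum_eq_sum_seq, sum_eq_sum_seq, ← h1, ← Finset.sum_sub_distrib]
  calc ‖∑ i ∈ Finset.range D.m, (∑ k ∈ Finset.Ico (τ i) (τ (i + 1)),
          A (D'.seq k) (D'.seq (k + 1)) - A (D.seq i) (D.seq (i + 1)))‖
      ≤ ∑ i ∈ Finset.range D.m, K * D.mesh ^ (p - 1) * (D.seq (i + 1) - D.seq i) := by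
        refine norm_sum_le_of_le _ fun i _ => ?_
        have h2 := hA _ _ (hτm (Nat.le_succ i))
        rw [hτs, hτs] at h2
        refine h2.trans ?_
        rw [mul_assoc]
        refine mul_le_mul_of_nonneg_left ?_ hK
        have h3 : 0 ≤ D.seq (i + 1) - D.seq i := sub_nonneg.2 (D.seq_monotone (Nat.le_succ i))
        calc (D.seq (i + 1) - D.seq i) ^ p
            = (D.seq (i + 1) - D.seq i) ^ (p - 1) * (D.seq (i + 1) - D.seq i) := by
              conv_rhs => rw [← Real.rpow_one (D.seq (i + 1) - D.seq i), ← Real.rpow_mul h3,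
                one_mul]
              rw [← Real.rpow_add_of_nonneg h3 (by linarith) zero_le_one, sub_add_cancel]
          _ ≤ _ := by
              gcongr
              exact D.seq_sub_le_mesh i
    _ = K * T * D.mesh ^ (p - 1) := by
        rw [← Finset.mul_sum, sum_seq_sub]
        ring

end Dissection

/-! ### Young's estimate and the Young integral -/

lemma Mat.norm_apply_le {e d : ℕ} (A : Mat e d) (v : EuclideanSpace ℝ (Fin d)) :
    ‖A.apply v‖ ≤ ‖A‖ * ‖v‖ := by
  refine le_of_sq_le_sq ?_ (by positivity)
  rw [mul_pow, EuclideanSpace.norm_sq_eq, EuclideanSpace.norm_sq_eq, EuclideanSpace.norm_sq_eq]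
  simp only [Real.norm_eq_abs, sq_abs, Mat.apply]
  rw [Fintype.sum_prod_type, Finset.sum_mul]
  exact Finset.sum_le_sum fun i _ => Finset.sum_mul_sq_le_sq_mul_sq _ _ _

lemma Mat.sub_apply {e d : ℕ} (A B : Mat e d) (v : EuclideanSpace ℝ (Fin d)) :
    (A - B).apply v = A.apply v - B.apply v := by
  ext i
  simp [Mat.apply, sub_mul]

lemma Mat.apply_add {e d : ℕ} (A : Mat e d) (v v' : EuclideanSpace ℝ (Fin d)) :
    A.apply (v + v') = A.apply v + A.apply v' := by
  ext i
  simp [Mat.apply, mul_add, Finset.sum_add_distrib]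

lemma Mat.continuous_apply {e d : ℕ} (v : EuclideanSpace ℝ (Fin d)) :
    Continuous fun A : Mat e d => A.apply v := by
  unfold Mat.apply
  fun_prop

/-- Young's estimate, uniformly over the integrands with a given Hölder constant. -/
theorem exists_norm_riemannSum_sub_riemannSum_le {e d : ℕ} {T : ℝ} (hT : 0 < T) {α β r C : ℝ≥0}
    (hαβ : 1 < α + β) {w : ℝ → EuclideanSpace ℝ (Fin d)} (hw : HolderOnWith C β w (Icc 0 T)) :
    ∃ K : ℝ, 0 ≤ K ∧ ∀ f : ℝ → Mat e d, HolderOnWith r α f (Icc 0 T) →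
      ∀ D₁ D₂ : Dissection T, ‖D₁.riemannSum f w - D₂.riemannSum f w‖ ≤
        K * D₁.mesh ^ ((α + β - 1 : ℝ)) + K * D₂.mesh ^ ((α + β - 1 : ℝ)) := by
  have hp : (1 : ℝ) < α + β := mod_cast hαβ
  obtain ⟨K, hK, h⟩ := exists_norm_sum_Ico_sub_le (E := EuclideanSpace ℝ (Fin e)) hp
    (M := r * C) (by positivity)
  refine ⟨K * T, by positivity, fun f hf D₁ D₂ => ?_⟩
  have hA := h (Icc 0 T) (fun a b => (f a).apply (w b - w a)) (by
    intro a ha b hb c hc hab hbc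
    -- The additivity defect is a product of an increment of `f` and one of `w`, whence the exponent
    -- `α + β`.
    have e1 : (f a).apply (w b - w a) + (f b).apply (w c - w b) - (f a).apply (w c - w a) =
        (f b - f a).apply (w c - w b) := by
      rw [Mat.sub_apply, show w c - w a = (w b - w a) + (w c - w b) by abel, Mat.apply_add]
      abel
    rw [e1]
    have hca : 0 ≤ c - a := by linarith
    have h1 : ‖f b - f a‖ ≤ r * (c - a) ^ (α : ℝ) := by
      rw [← dist_eq_norm]
      exact hf.dist_le_of_le hb ha (by rw [Real.dist_eq, abs_of_nonneg] <;> linarith)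
    have h2 : ‖w c - w b‖ ≤ C * (c - a) ^ (β : ℝ) := by
      rw [← dist_eq_norm]
      exact hw.dist_le_of_le hc hb (by rw [Real.dist_eq, abs_of_nonneg] <;> linarith)
    calc ‖(f b - f a).apply (w c - w b)‖ ≤ ‖f b - f a‖ * ‖w c - w b‖ := Mat.norm_apply_le _ _
      _ ≤ (r * (c - a) ^ (α : ℝ)) * (C * (c - a) ^ (β : ℝ)) := by gcongr
      _ = r * C * (c - a) ^ ((α : ℝ) + β) := by
        rw [Real.rpow_add_of_nonneg hca α.coe_nonneg β.coe_nonneg]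
        ring)
  obtain ⟨D, hD₁, hD₂⟩ := Dissection.exists_common_refinement D₁ D₂
  have hD := hA D.seq D.seq_monotone D.seq_mem
  have b1 := Dissection.norm_sum_refinement_sub_le hp hK
    (fun a b => (f a).apply (w b - w a)) D₁ D hD₁ hD
  have b2 := Dissection.norm_sum_refinement_sub_le hp hK
    (fun a b => (f a).apply (w b - w a)) D₂ D hD₂ hD
  rw [norm_sub_rev] at b1
  exact (norm_sub_le_norm_sub_add_norm_sub _ (D.riemannSum f w) _).trans (add_le_add b1 b2)

lemma tendsto_const_mul_mesh_rpow {T : ℝ} (K : ℝ) {θ : ℝ} (hθ : 0 < θ) {D : ℕ → Dissection T}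
    (hD : Tendsto (fun n => (D n).mesh) atTop (𝓝 0)) :
    Tendsto (fun n => K * (D n).mesh ^ θ) atTop (𝓝 0) := by
  have := (hD.rpow_const (Or.inr hθ.le)).const_mul K
  rwa [Real.zero_rpow hθ.ne', mul_zero] at this

/-- Hölder integrands have a Young integral if there are dissections of arbitrarily small mesh. -/
theorem exists_isYoungIntegral {e d : ℕ} {T K θ : ℝ} (hθ : 0 < θ) {f : ℝ → Mat e d}
    {w : ℝ → EuclideanSpace ℝ (Fin d)}
    (h : ∀ D₁ D₂ : Dissection T, ‖D₁.riemannSum f w - D₂.riemannSum f w‖ ≤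
      K * D₁.mesh ^ θ + K * D₂.mesh ^ θ) {D : ℕ → Dissection T}
    (hD : Tendsto (fun n => (D n).mesh) atTop (𝓝 0)) : ∃ I, IsYoungIntegral T f w I := by
  have hlim := tendsto_const_mul_mesh_rpow K hθ hD
  have hc : CauchySeq fun n => (D n).riemannSum f w := by
    rw [Metric.cauchySeq_iff']
    intro ε hε
    obtain ⟨N, hN⟩ := eventually_atTop.1 (hlim.eventually (gt_mem_nhds (half_pos hε)))
    refine ⟨N, fun n hn => ?_⟩
    rw [dist_eq_norm]
    linarith [h (D n) (D N), hN n hn, hN N le_rfl]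
  obtain ⟨I, hI⟩ := cauchySeq_tendsto_of_complete hc
  refine ⟨I, fun D' hD' => ?_⟩
  have hz : Tendsto (fun n => (D' n).riemannSum f w - (D n).riemannSum f w) atTop (𝓝 0) := by
    refine squeeze_zero_norm (fun n => h (D' n) (D n)) ?_
    simpa using (tendsto_const_mul_mesh_rpow K hθ hD').add hlim
  simpa using hz.add hI

/-- The mesh of the second dissection is sent to `0` in the two-dissection bound. The sequence `D`
is needed: without one of vanishing mesh, `IsYoungIntegral` would be vacuous. -/
lemma IsYoungIntegral.norm_riemannSum_sub_le {e d : ℕ} {T K θ : ℝ} (hθ : 0 < θ) {f : ℝ → Mat e d}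
    {w : ℝ → EuclideanSpace ℝ (Fin d)} {I : EuclideanSpace ℝ (Fin e)} (hI : IsYoungIntegral T f w I)
    (h : ∀ D₁ D₂ : Dissection T, ‖D₁.riemannSum f w - D₂.riemannSum f w‖ ≤
      K * D₁.mesh ^ θ + K * D₂.mesh ^ θ) {D : ℕ → Dissection T}
    (hD : Tendsto (fun n => (D n).mesh) atTop (𝓝 0)) (D' : Dissection T) :
    ‖D'.riemannSum f w - I‖ ≤ K * D'.mesh ^ θ := by
  have h1 := ((hI D hD).const_sub (D'.riemannSum f w)).norm
  have h2 := (tendsto_const_mul_mesh_rpow K hθ hD).const_add (K * D'.mesh ^ θ)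
  rw [add_zero] at h2
  exact le_of_tendsto_of_tendsto' h1 h2 fun n => h D' (D n)

end AumannYoung

namespace AumannYoung

/-! ### Linear interpolation preserves Hölder constants -/

namespace Dissection

variable {T : ℝ} (D : Dissection T)

/-- Every point of `[0, T]` lies in an interval of a dissection. -/
lemma exists_mem_Icc (hT : 0 < T) {x : ℝ} (hx : x ∈ Icc 0 T) :
    ∃ i : Fin D.m, x ∈ Icc (D.t i.castSucc) (D.t i.succ) := by
  classical
  have hex : ∃ k, x ≤ D.seq (k + 1) := ⟨D.m, by
    refine hx.2.trans (D.seq_m.ge.trans (D.seq_monotone (Nat.le_succ _)))⟩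
  have hm : D.m ≠ 0 := by
    intro h
    have h1 := D.seq_m
    rw [h, D.seq_zero] at h1
    exact hT.ne h1
  have hlt : Nat.find hex < D.m := by
    have := Nat.find_min' hex (m := D.m - 1) (by
      rw [Nat.sub_add_cancel (Nat.pos_of_ne_zero hm), D.seq_m]
      exact hx.2)
    omega
  refine ⟨⟨Nat.find hex, hlt⟩, ?_, ?_⟩
  · rw [← D.seq_coe]
    change D.seq (Nat.find hex) ≤ x
    rcases Nat.eq_zero_or_pos (Nat.find hex) with h | h
    · rw [h, D.seq_zero]
      exact hx.1
    · have := Nat.find_min hex (m := Nat.find hex - 1) (by omega)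
      rw [Nat.sub_add_cancel h] at this
      exact (not_le.1 this).le
  · rw [← D.seq_coe]
    exact Nat.find_spec hex

lemma le_castSucc_or_succ_le (i : Fin D.m) (k : Fin (D.m + 1)) :
    D.t k ≤ D.t i.castSucc ∨ D.t i.succ ≤ D.t k := by
  rcases le_or_gt k i.castSucc with h | h
  · exact Or.inl (D.strictMono.monotone h)
  · exact Or.inr (D.strictMono.monotone (Fin.castSucc_lt_iff_succ_le.1 h))

lemma weight_nonneg_left {i : Fin D.m} {x : ℝ} (hx : x ∈ Icc (D.t i.castSucc) (D.t i.succ)) :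
    0 ≤ (D.t i.succ - x) / (D.t i.succ - D.t i.castSucc) :=
  div_nonneg (sub_nonneg.2 hx.2) (D.pos i).le

lemma weight_nonneg_right {i : Fin D.m} {x : ℝ} (hx : x ∈ Icc (D.t i.castSucc) (D.t i.succ)) :
    0 ≤ (x - D.t i.castSucc) / (D.t i.succ - D.t i.castSucc) :=
  div_nonneg (sub_nonneg.2 hx.1) (D.pos i).le

lemma weight_add (i : Fin D.m) (x : ℝ) :
    (D.t i.succ - x) / (D.t i.succ - D.t i.castSucc) +
      (x - D.t i.castSucc) / (D.t i.succ - D.t i.castSucc) = 1 := by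
  rw [← add_div, sub_add_sub_cancel, div_self (D.pos i).ne']

lemma weight_combo (i : Fin D.m) (x : ℝ) :
    (D.t i.succ - x) / (D.t i.succ - D.t i.castSucc) * D.t i.castSucc +
      (x - D.t i.castSucc) / (D.t i.succ - D.t i.castSucc) * D.t i.succ = x := by
  have := (D.pos i).ne'
  field_simp
  ring

variable {V : Type*} [NormedAddCommGroup V] [NormedSpace ℝ V]

/-- The interpolation of `f` along `D` on the interval `[t_i, t_{i+1}]`. -/
noncomputable def linePiece (f : ℝ → V) (i : Fin D.m) (x : ℝ) : V :=
  ((D.t i.succ - x) / (D.t i.succ - D.t i.castSucc)) • f (D.t i.castSucc) +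
    ((x - D.t i.castSucc) / (D.t i.succ - D.t i.castSucc)) • f (D.t i.succ)

lemma linePiece_left (f : ℝ → V) (i : Fin D.m) :
    D.linePiece f i (D.t i.castSucc) = f (D.t i.castSucc) := by
  rw [linePiece, sub_self, zero_div, div_self (D.pos i).ne', one_smul, zero_smul, add_zero]

lemma linePiece_right (f : ℝ → V) (i : Fin D.m) :
    D.linePiece f i (D.t i.succ) = f (D.t i.succ) := by
  rw [linePiece, sub_self, zero_div, div_self (D.pos i).ne', one_smul, zero_smul, zero_add]

lemma linePiece_congr_of_lt (f : ℝ → V) {i j : Fin D.m} (hij : i < j) {x : ℝ}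
    (hi : x ∈ Icc (D.t i.castSucc) (D.t i.succ)) (hj : x ∈ Icc (D.t j.castSucc) (D.t j.succ)) :
    D.linePiece f i x = D.linePiece f j x := by
  have h1 : D.t i.succ ≤ D.t j.castSucc :=
    D.strictMono.monotone (Fin.succ_le_castSucc_iff.2 hij)
  have h2 : x = D.t i.succ := le_antisymm hi.2 (h1.trans hj.1)
  have h3 : x = D.t j.castSucc := le_antisymm (hi.2.trans h1) hj.1
  calc D.linePiece f i x = f x := by rw [h2, linePiece_right]
    _ = D.linePiece f j x := by rw [h3, linePiece_left]

/-- The piecewise linear interpolation of a function along a dissection. -/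
theorem exists_line (f : ℝ → V) : ∃ g : ℝ → V, ∀ (i : Fin D.m),
    ∀ x ∈ Icc (D.t i.castSucc) (D.t i.succ), g x = D.linePiece f i x := by
  classical
  refine ⟨fun x => if h : ∃ i : Fin D.m, x ∈ Icc (D.t i.castSucc) (D.t i.succ) then
    D.linePiece f h.choose x else f x, fun i x hx => ?_⟩
  have h : ∃ i : Fin D.m, x ∈ Icc (D.t i.castSucc) (D.t i.succ) := ⟨i, hx⟩
  simp only [dif_pos h]
  rcases lt_trichotomy h.choose i with hlt | heq | hgt
  · exact D.linePiece_congr_of_lt f hlt h.choose_spec hx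
  · rw [heq]
  · exact (D.linePiece_congr_of_lt f hgt hx h.choose_spec).symm

/-- Triangle inequality, then Jensen for the concave function `t ↦ t ^ α`; this is why no factor is
lost in `r`. -/
lemma norm_combo_sub_le {α : ℝ} (hα : 0 ≤ α) (hα1 : α ≤ 1) {r p q A B : ℝ} (hr : 0 ≤ r)
    (hp : 0 ≤ p) (hq : 0 ≤ q) (hpq : p + q = 1) (hA : 0 ≤ A) (hB : 0 ≤ B) {u v z : V}
    (hu : ‖u - z‖ ≤ r * A ^ α) (hv : ‖v - z‖ ≤ r * B ^ α) :
    ‖p • u + q • v - z‖ ≤ r * (p * A + q * B) ^ α := by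
  have h1 : p • u + q • v - z = p • (u - z) + q • (v - z) := by
    rw [smul_sub, smul_sub]
    nth_rewrite 1 [← one_smul ℝ z]
    rw [← hpq, add_smul]
    abel
  have h2 := (Real.concaveOn_rpow hα hα1).2 (mem_Ici.2 hA) (mem_Ici.2 hB) hp hq hpq
  simp only [smul_eq_mul] at h2
  calc ‖p • u + q • v - z‖ ≤ p * ‖u - z‖ + q * ‖v - z‖ := by
        rw [h1]
        refine (norm_add_le _ _).trans_eq ?_
        rw [norm_smul, norm_smul, Real.norm_of_nonneg hp, Real.norm_of_nonneg hq]
    _ ≤ p * (r * A ^ α) + q * (r * B ^ α) := by gcongr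
    _ = r * (p * A ^ α + q * B ^ α) := by ring
    _ ≤ _ := by gcongr

/-- If `z` is Hölder close to the values of `f` at both ends of an interval, then it is Hölder close
to the interpolation. -/
lemma norm_linePiece_sub_le {α : ℝ} (hα : 0 ≤ α) (hα1 : α ≤ 1) {r : ℝ} (hr : 0 ≤ r) {f : ℝ → V}
    {z : V} {y : ℝ} {i : Fin D.m} {x : ℝ} (hx : x ∈ Icc (D.t i.castSucc) (D.t i.succ))
    (hy : y ≤ D.t i.castSucc ∨ D.t i.succ ≤ y)
    (h1 : ‖f (D.t i.castSucc) - z‖ ≤ r * |D.t i.castSucc - y| ^ α)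
    (h2 : ‖f (D.t i.succ) - z‖ ≤ r * |D.t i.succ - y| ^ α) :
    ‖D.linePiece f i x - z‖ ≤ r * |x - y| ^ α := by
  refine (norm_combo_sub_le hα hα1 hr (D.weight_nonneg_left hx) (D.weight_nonneg_right hx)
    (D.weight_add i x) (abs_nonneg _) (abs_nonneg _) h1 h2).trans_eq ?_
  -- As `y` is not interior to the interval, the distances to `y` are affine on it, so their
  -- weighted mean is exactly `|x - y|`.
  congr 2
  have e1 := D.weight_add i x
  have e2 := D.weight_combo i x
  set p := (D.t i.succ - x) / (D.t i.succ - D.t i.castSucc)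
  set q := (x - D.t i.castSucc) / (D.t i.succ - D.t i.castSucc)
  have e3 := D.pos i
  rcases hy with hy | hy
  · rw [abs_of_nonneg (by linarith), abs_of_nonneg (by linarith),
      abs_of_nonneg (by linarith [hx.1])]
    linear_combination e2 - y * e1
  · rw [abs_of_nonpos (by linarith), abs_of_nonpos (by linarith),
      abs_of_nonpos (by linarith [hx.2])]
    linear_combination -e2 + y * e1

/-- Piecewise linear interpolation does not increase the Hölder constant. -/
theorem holderOnWith_of_eq_linePiece (hT : 0 < T) {α r : ℝ≥0} (hα1 : α ≤ 1) {f g : ℝ → V}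
    (hf : HolderOnWith r α f (Icc 0 T))
    (hg : ∀ (i : Fin D.m), ∀ x ∈ Icc (D.t i.castSucc) (D.t i.succ), g x = D.linePiece f i x) :
    HolderOnWith r α g (Icc 0 T) := by
  have hα0 : (0 : ℝ) ≤ α := α.coe_nonneg
  have hα1' : (α : ℝ) ≤ 1 := mod_cast hα1
  have hff : ∀ x ∈ Icc 0 T, ∀ y ∈ Icc 0 T, ‖f x - f y‖ ≤ r * |x - y| ^ (α : ℝ) := by
    intro x hx y hy
    rw [← dist_eq_norm, ← Real.dist_eq]
    exact hf.dist_le hx hy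
  have hgf : ∀ x ∈ Icc 0 T, ∀ k, ‖g x - f (D.t k)‖ ≤ r * |x - D.t k| ^ (α : ℝ) := by
    intro x hx k
    obtain ⟨i, hi⟩ := D.exists_mem_Icc hT hx
    rw [hg i x hi]
    exact D.norm_linePiece_sub_le hα0 hα1' r.coe_nonneg hi (D.le_castSucc_or_succ_le i k)
      (hff _ (D.t_mem _) _ (D.t_mem _)) (hff _ (D.t_mem _) _ (D.t_mem _))
  have hgg : ∀ x ∈ Icc 0 T, ∀ y ∈ Icc 0 T, ‖g x - g y‖ ≤ r * |x - y| ^ (α : ℝ) := by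
    intro x hx y hy
    obtain ⟨i, hi⟩ := D.exists_mem_Icc hT hx
    -- Inside a common interval the concavity argument does not apply. There `g` is affine, and `s ≤
    -- s ^ α` for `s = |x - y| / δ ≤ 1` suffices. Otherwise `norm_linePiece_sub_le` applies with `z
    -- = g y`.
    by_cases hyi : y ∈ Icc (D.t i.castSucc) (D.t i.succ)
    · rw [hg i x hi, hg i y hyi]
      have hpos := D.pos i
      set δ := D.t i.succ - D.t i.castSucc with hδ
      have e : D.linePiece f i x - D.linePiece f i y =
          ((x - y) / δ) • (f (D.t i.succ) - f (D.t i.castSucc)) := by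
        have e1 : (x - y) / δ = (x - D.t i.castSucc) / δ - (y - D.t i.castSucc) / δ := by
          rw [← sub_div]
          ring
        have e2 := D.weight_add i x
        have e3 := D.weight_add i y
        rw [linePiece, linePiece, eq_sub_of_add_eq e2, eq_sub_of_add_eq e3, ← hδ, e1]
        module
      rw [e, norm_smul, Real.norm_eq_abs, abs_div, abs_of_pos hpos]
      have hle : |x - y| ≤ δ := abs_le.2 ⟨by linarith [hi.1, hyi.2], by linarith [hi.2, hyi.1]⟩
      have h1 := hff _ (D.t_mem i.succ) _ (D.t_mem i.castSucc)
      rw [← hδ, abs_of_pos hpos] at h1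
      have h2 : |x - y| / δ ≤ (|x - y| / δ) ^ (α : ℝ) :=
        Real.self_le_rpow_of_le_one (by positivity) ((div_le_one hpos).2 hle) hα1'
      calc |x - y| / δ * ‖f (D.t i.succ) - f (D.t i.castSucc)‖
          ≤ (|x - y| / δ) ^ (α : ℝ) * (r * δ ^ (α : ℝ)) := by gcongr
        _ = r * ((|x - y| / δ) * δ) ^ (α : ℝ) := by
          rw [Real.mul_rpow (by positivity) hpos.le]
          ring
        _ = r * |x - y| ^ (α : ℝ) := by rw [div_mul_cancel₀ _ hpos.ne']
    · rw [hg i x hi]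
      refine D.norm_linePiece_sub_le hα0 hα1' r.coe_nonneg hi ?_ ?_ ?_
      · rw [mem_Icc, not_and_or, not_le, not_le] at hyi
        exact hyi.imp le_of_lt le_of_lt
      · rw [norm_sub_rev, abs_sub_comm]
        exact hgf y hy _
      · rw [norm_sub_rev, abs_sub_comm]
        exact hgf y hy _
  intro x hx y hy
  have h := hgg x hx y hy
  rw [edist_dist, edist_dist, dist_eq_norm, Real.dist_eq,
    ENNReal.ofReal_rpow_of_nonneg (abs_nonneg _) hα0, ← ENNReal.ofReal_coe_nnreal,
    ← ENNReal.ofReal_mul r.coe_nonneg]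
  exact ENNReal.ofReal_le_ofReal h

end Dissection

/-! ### Selections of the interpolated multifunction and their limits -/

lemma measurable_domRestrict_of_holderOnWith {V : Type*} [NormedAddCommGroup V]
    [MeasurableSpace V] [BorelSpace V] {T : ℝ} {α r : ℝ≥0} (hα : 0 < α) {f : ℝ → V}
    (hf : HolderOnWith r α f (Icc 0 T)) : Measurable ((Icc 0 T).domRestrict f) :=
  (continuousOn_iff_continuous_domRestrict.1 (hf.continuousOn hα)).measurable

/-- The interpolation of a Hölder selection of `F` is a Hölder selection of the interpolation of `F`
with the same Riemann sum. -/
theorem exists_mem_holderSelections_interpolate {d e : ℕ} {T : ℝ} (hT : 0 < T) {α r : ℝ≥0}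
    (hα : 0 < α) (hα1 : α ≤ 1) {F : ℝ → ConvexBody (Mat e d)} {f : ℝ → Mat e d}
    (hf : f ∈ holderSelections T α r F) (w : ℝ → EuclideanSpace ℝ (Fin d)) (D : Dissection T) :
    ∃ g ∈ holderSelections T α r (D.interpolate F), D.riemannSum g w = D.riemannSum f w := by
  obtain ⟨g, hg⟩ := D.exists_line f
  have hgh := D.holderOnWith_of_eq_linePiece hT hα1 hf.2 hg
  refine ⟨g, ⟨⟨measurable_domRestrict_of_holderOnWith hα hgh, fun x hx => ?_⟩, hgh⟩, ?_⟩
  · obtain ⟨i, hi⟩ := D.exists_mem_Icc hT hx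
    rw [hg i x hi, D.interpolate_eq F i hi, ← SetLike.mem_coe, ConvexBody.coe_add,
      ConvexBody.coe_smul, ConvexBody.coe_smul]
    exact add_mem_add (smul_mem_smul_set (hf.1.2 _ (D.t_mem _)))
      (smul_mem_smul_set (hf.1.2 _ (D.t_mem _)))
  · refine Finset.sum_congr rfl fun i _ => ?_
    rw [hg i _ (left_mem_Icc.2 (sub_nonneg.1 (D.pos i).le)), D.linePiece_left]

/-- Points of the interpolation are close to the interpolated multifunction. -/
theorem exists_mem_dist_interpolate_le {d e : ℕ} {T : ℝ} (hT : 0 < T) {α C : ℝ≥0}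
    {F : ℝ → ConvexBody (Mat e d)} (hF : HolderOnWith C α F (Icc 0 T)) (D : Dissection T) {x : ℝ}
    (hx : x ∈ Icc 0 T) {y : Mat e d} (hy : y ∈ D.interpolate F x) :
    ∃ z ∈ F x, dist y z ≤ C * D.mesh ^ (α : ℝ) := by
  obtain ⟨i, hi⟩ := D.exists_mem_Icc hT hx
  have hclose : ∀ s ∈ Icc 0 T, |s - x| ≤ D.mesh → ∀ u ∈ F s,
      ∃ z ∈ F x, dist u z ≤ C * D.mesh ^ (α : ℝ) := by
    intro s hs hsx u hu
    have h1 := hF.dist_le_of_le hs hx (d := D.mesh) hsx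
    rw [← ConvexBody.hausdorffDist_coe] at h1
    obtain ⟨z, hz, hz'⟩ := (F x).isCompact.exists_infDist_eq_dist (F x).nonempty u
    refine ⟨z, hz, ?_⟩
    rw [← hz']
    refine (Metric.infDist_le_hausdorffDist_of_mem hu ?_).trans h1
    exact (F s).hausdorffEDist_ne_top
  rw [D.interpolate_eq F i hi, ← SetLike.mem_coe, ConvexBody.coe_add,
    ConvexBody.coe_smul, ConvexBody.coe_smul] at hy
  obtain ⟨_, ⟨u, hu, rfl⟩, _, ⟨v, hv, rfl⟩, rfl⟩ := hy
  have hm := D.sub_le_mesh i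
  obtain ⟨u', hu', huu⟩ := hclose _ (D.t_mem _)
    (abs_le.2 ⟨by linarith [hi.2], by linarith [hi.1, D.mesh_nonneg]⟩) u hu
  obtain ⟨v', hv', hvv⟩ := hclose _ (D.t_mem _)
    (abs_le.2 ⟨by linarith [hi.2, D.mesh_nonneg], by linarith [hi.1]⟩) v hv
  have p0 := D.weight_nonneg_left hi
  have q0 := D.weight_nonneg_right hi
  have hpq := D.weight_add i x
  -- Convexity of `F x` keeps the combination of the two nearby points, with the same weights,
  -- inside `F x`.
  refine ⟨_, (F x).convex hu' hv' p0 q0 hpq, ?_⟩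
  set p := (D.t i.succ - x) / (D.t i.succ - D.t i.castSucc)
  set q := (x - D.t i.castSucc) / (D.t i.succ - D.t i.castSucc)
  refine (dist_add_add_le _ _ _ _).trans ?_
  simp only [dist_smul₀, Real.norm_of_nonneg p0, Real.norm_of_nonneg q0]
  calc p * dist u u' + q * dist v v'
      ≤ p * (C * D.mesh ^ (α : ℝ)) + q * (C * D.mesh ^ (α : ℝ)) := by gcongr
    _ = C * D.mesh ^ (α : ℝ) := by rw [← add_mul, hpq, one_mul]

/-- Pointwise limits of Hölder selections of the interpolations are Hölder selections. -/
theorem exists_mem_holderSelections_tendsto {d e : ℕ} {T : ℝ} (hT : 0 < T) {α r C : ℝ≥0}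
    (hα : 0 < α) {F : ℝ → ConvexBody (Mat e d)} (hF : HolderOnWith C α F (Icc 0 T))
    {D : ℕ → Dissection T} (U : Ultrafilter ℕ) (hD : Tendsto (fun n => (D n).mesh) U (𝓝 0))
    {f : ℕ → ℝ → Mat e d} (hf : ∀ᶠ n in U, f n ∈ holderSelections T α r ((D n).interpolate F)) :
    ∃ g ∈ holderSelections T α r F, ∀ x ∈ Icc 0 T, Tendsto (fun n => f n x) U (𝓝 (g x)) := by
  have hα0 : (0 : ℝ) < α := hα
  have hlim : ∀ x ∈ Icc 0 T, ∃ y ∈ F x, Tendsto (fun n => f n x) U (𝓝 y) := by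
    intro x hx
    -- Where `f n x` is not in the interpolated value, any point of `F x` serves: the whole sequence
    -- `z` then lies in one compact set.
    have hz : ∀ n, ∃ z ∈ F x, f n x ∈ (D n).interpolate F x →
        dist (f n x) z ≤ C * (D n).mesh ^ (α : ℝ) := by
      intro n
      by_cases h : f n x ∈ (D n).interpolate F x
      · obtain ⟨z, hz, hz'⟩ := exists_mem_dist_interpolate_le hT hF (D n) hx h
        exact ⟨z, hz, fun _ => hz'⟩
      · obtain ⟨z, hz⟩ := (F x).nonempty
        exact ⟨z, hz, fun h' => absurd h' h⟩
    choose z hzF hz using hz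
    obtain ⟨y, hy, hUy⟩ := (F x).isCompact.ultrafilter_le_nhds (U.map z) (by
      rw [le_principal_iff]
      exact Filter.mem_map.2 (univ_mem' hzF))
    refine ⟨y, hy, ?_⟩
    have hzero : Tendsto (fun n => (C : ℝ) * (D n).mesh ^ (α : ℝ)) U (𝓝 0) := by
      have := (hD.rpow_const (Or.inr hα0.le)).const_mul (C : ℝ)
      rwa [Real.zero_rpow hα0.ne', mul_zero] at this
    have hdist : Tendsto (fun n => dist (z n) (f n x)) U (𝓝 0) := by
      refine squeeze_zero' (Eventually.of_forall fun _ => dist_nonneg) ?_ hzero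
      filter_upwards [hf] with n hn
      rw [dist_comm]
      exact hz n (hn.1.2 x hx)
    have hzy : Tendsto z U (𝓝 y) := hUy
    exact (tendsto_iff_of_dist hdist).1 hzy
  choose! g hgF hg using hlim
  have hgh : HolderOnWith r α g (Icc 0 T) := by
    intro x hx y hy
    refine le_of_tendsto ((hg x hx).edist (hg y hy)) ?_
    filter_upwards [hf] with n hn
    exact hn.2 x hx y hy
  exact ⟨g, ⟨⟨measurable_domRestrict_of_holderOnWith hα hgh, hgF⟩, hgh⟩, hg⟩

end AumannYoung

/-! ### Convergence of the Aumann-Young integrals -/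

theorem mainTheorem7 {d e : ℕ} {T : ℝ} (hT : 0 < T) (α β r : ℝ≥0) (hα : 0 < α) (hα1 : α ≤ 1)
    (hβ : 0 < β) (hβ1 : β ≤ 1) (hαβ : 1 < α + β)
    (F : ℝ → ConvexBody (AumannYoung.Mat e d)) (hF : ∃ C, HolderOnWith C α F (Icc 0 T))
    (w : ℝ → EuclideanSpace ℝ (Fin d)) (hw : ∃ C, HolderOnWith C β w (Icc 0 T))
    (D : ℕ → AumannYoung.Dissection T) (hD : Tendsto (fun n => (D n).mesh) atTop (𝓝 0)) :
    Tendsto (fun n => Metric.hausdorffEDist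
      (AumannYoung.integral T α r ((D n).interpolate F) w)
      (AumannYoung.integral T α r F w)) atTop (𝓝 0) := by
  open AumannYoung in
  obtain ⟨C, hF⟩ := hF
  obtain ⟨Cw, hw⟩ := hw
  have hθ : (0 : ℝ) < α + β - 1 := sub_pos.2 (mod_cast hαβ)
  obtain ⟨K, hK, hbound⟩ :=
    exists_norm_riemannSum_sub_riemannSum_le (e := e) (r := r) hT hαβ hw
  have hmesh := tendsto_const_mul_mesh_rpow K hθ hD
  rw [ENNReal.tendsto_nhds_zero]
  intro ε hε
  obtain ⟨δ, hδ, hδε⟩ := ENNReal.lt_iff_exists_nnreal_btwn.1 hε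
  have hδ0 : (0 : ℝ) < δ := mod_cast hδ
  -- Thirds of `δ` serve the second inclusion: two Young errors and one distance between Riemann
  -- sums.
  have hsmall := hmesh.eventually (gt_mem_nhds (div_pos hδ0 (three_pos)))
  have hto : ∀ᶠ n in atTop, ∀ j ∈ integral T α r F w,
      ∃ j' ∈ integral T α r ((D n).interpolate F) w, dist j j' ≤ δ := by
    filter_upwards [hsmall] with n hn
    rintro j ⟨f, hf, hj⟩
    obtain ⟨g, hg, hgf⟩ := exists_mem_holderSelections_interpolate hT hα hα1 hf w (D n)
    obtain ⟨I, hI⟩ := exists_isYoungIntegral hθ (hbound g hg.2) hD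
    refine ⟨I, ⟨g, hg, hI⟩, ?_⟩
    have h1 := hj.norm_riemannSum_sub_le hθ (hbound f hf.2) hD (D n)
    have h2 := hI.norm_riemannSum_sub_le hθ (hbound g hg.2) hD (D n)
    rw [hgf, ← dist_eq_norm] at h2
    rw [← dist_eq_norm] at h1
    linarith [dist_triangle_left j I ((D n).riemannSum f w)]
  have hfrom : ∀ᶠ n in atTop, ∀ j ∈ integral T α r ((D n).interpolate F) w,
      ∃ j' ∈ integral T α r F w, dist j j' ≤ δ := by
    by_contra hcon
    rw [not_eventually] at hcon
    -- The failing indices are frequent, so some ultrafilter finer than `atTop` contains them.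
    obtain ⟨U, hU⟩ := Filter.exists_ultrafilter_iff.2 (frequently_mem_iff_neBot.1 hcon)
    have hUtop : (U : Filter ℕ) ≤ atTop := hU.trans inf_le_left
    have hbad : ∀ᶠ n in U, ¬ ∀ j ∈ integral T α r ((D n).interpolate F) w,
      ∃ j' ∈ integral T α r F w, dist j j' ≤ δ := le_principal_iff.1 (hU.trans inf_le_right)
    have hfj : ∀ n, ∃ (f : ℝ → Mat e d) (j : EuclideanSpace ℝ (Fin e)),
        (¬ ∀ j ∈ integral T α r ((D n).interpolate F) w,
          ∃ j' ∈ integral T α r F w, dist j j' ≤ δ) →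
        f ∈ holderSelections T α r ((D n).interpolate F) ∧ IsYoungIntegral T f w j ∧
          ∀ j' ∈ integral T α r F w, δ < dist j j' := by
      intro n
      by_cases h : ∀ j ∈ integral T α r ((D n).interpolate F) w,
          ∃ j' ∈ integral T α r F w, dist j j' ≤ δ
      · exact ⟨0, 0, fun h' => absurd h h'⟩
      · push Not at h
        obtain ⟨j, ⟨f, hf, hj⟩, h⟩ := h
        exact ⟨f, j, fun _ => ⟨hf, hj, h⟩⟩
    choose f j hfj using hfj
    obtain ⟨g, hg, hlim⟩ := exists_mem_holderSelections_tendsto hT hα hF U (hD.mono_left hUtop)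
      (hbad.mono fun n hn => (hfj n hn).1)
    obtain ⟨I, hI⟩ := exists_isYoungIntegral hθ (hbound g hg.2) hD
    -- `N` is fixed independently of `n`: `D N` only serves as a fine dissection on which all the `f
    -- n` are compared with `g`.
    obtain ⟨N, hN⟩ := hsmall.exists
    have hsum : Tendsto (fun n => (D N).riemannSum (f n) w) U (𝓝 ((D N).riemannSum g w)) :=
      tendsto_finsetSum _ fun i _ =>
        ((Mat.continuous_apply _).tendsto _).comp (hlim _ ((D N).t_mem _))
    have hclose := hsum.eventually (Metric.ball_mem_nhds _ (div_pos hδ0 (three_pos)))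
    obtain ⟨n, hn, hn'⟩ := (hbad.and hclose).exists
    obtain ⟨h1, h2, h3⟩ := hfj n hn
    have h4 := h3 I ⟨g, hg, hI⟩
    have h5 := h2.norm_riemannSum_sub_le hθ (hbound _ h1.2) hD (D N)
    have h6 := hI.norm_riemannSum_sub_le hθ (hbound _ hg.2) hD (D N)
    rw [← dist_eq_norm] at h5 h6
    have h7 : dist ((D N).riemannSum (f n) w) ((D N).riemannSum g w) < δ / 3 := hn'
    have h8 := dist_triangle_left (j n) I ((D N).riemannSum (f n) w)
    have h9 := dist_triangle ((D N).riemannSum (f n) w) ((D N).riemannSum g w) I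
    linarith
  -- The two one-sided statements also cover emptiness: if one set is empty, so is the other.
  filter_upwards [hto, hfrom] with n h1 h2
  refine le_trans (Metric.hausdorffEDist_le_of_mem_edist (r := (δ : ℝ≥0∞)) ?_ ?_) hδε.le
  · intro x hx
    obtain ⟨y, hy, hxy⟩ := h2 x hx
    exact ⟨y, hy, by rw [edist_nndist]; exact mod_cast hxy⟩
  · intro x hx
    obtain ⟨y, hy, hxy⟩ := h1 x hx
    exact ⟨y, hy, by rw [edist_nndist]; exact mod_cast hxy⟩
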